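/- Let $S$ be a Riemann surface (connected, Hausdorff) and let $\nabla$ be a meromorphic connection on $TS$, i.e. a $\mathbb{C}$-linear morphism $\nabla:\mathcal{M}_{TS}\to\mathcal{M}^1_S\otimes\mathcal{M}_{TS}$, from the sheaf of germs of meromorphic sections of $TS$ to the sheaf of germs of meromorphic $TS$-valued $1$-forms, with $\nabla(fs)=df\otimes s+f\nabla s$. In a local holomorphic chart $(U_\alpha,z_\alpha)$ write $\nabla(\partial/\partial z_\alpha)=\eta_\alpha\otimes\partial/\partial z_\alpha$, where $\eta_\alpha=f_\alpha\,dz_\alpha$ is a meromorphic $1$-form on $U_\alpha$. The poles of $\nabla$, their orders and the residues $\mathrm{Res}_p\nabla$ are those of the $\eta_\alpha$; let $S^o$ be the complement of the set of poles in $S$. Assume that 1. $\nabla$ is Fuchsian: all its poles are simple; 2. $\nabla$ has monodromy in $\mathbb{Z}_2=\{1,-1\}$: there is an atlas $\{(U_\alpha,z_\alpha)\}$ of $S^o$ with $\eta_\alpha\equiv 0$ for all $\alpha$ and with transition functions $z_\beta=a_{\alpha\beta}z_\alpha+c_{\alpha\beta}$ on $U_\alpha\cap U_\beta$, where $a_{\alpha\beta}\in\{1,-1\}$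 and $c_{\alpha\beta}\in\mathbb{C}$; 3. $\mathrm{Res}_p\nabla\in\frac12\mathbb{Z}$ for all $p\in S$. Let $I\subseteq\mathbb{R}$ be a nondegenerate interval and let $\sigma:I\to S^o$ be a geodesic of $\nabla$, i.e. a smooth curve with $\nabla_{\sigma'}\sigma'\equiv 0$, which in local charts means $(z_\alpha\circ\sigma)''+(f_\alpha\circ\sigma)\,\big((z_\alpha\circ\sigma)'\big)^2\equiv 0$. If $\sigma$ is self-intersecting, i.e. $\sigma(s)=\sigma(t)$ for some $s\neq t$ in $I$, then $\sigma$ is periodic: there is $l>0$ such that $I$ contains a segment $[t,t+l]$, and $\sigma(t+l)=\sigma(t)$ and $\sigma'(t+l)=\sigma'(t)$ for all $t\in I$ with $t+l\in I$. -/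

import Mathlib

open Set Filter Topology
open scoped Manifold ContDiff

noncomputable section

namespace RiemannSurface

variable {S : Type*} [TopologicalSpace S] [ChartedSpace ℂ S]

/-! ### Meromorphic functions, vector fields and endomorphism-valued fields

A meromorphic object is represented by an everywhere defined function whose values at its poles
(and at isolated points) are irrelevant: two representatives are identified near `p` when they
agree on a punctured neighbourhood of `p`. -/

/-- `f` is (represents) a meromorphic function near `p`. -/
def MeromorphicFunAt (f : S → ℂ) (p : S) : Prop :=
  MeromorphicAt (f ∘ (chartAt ℂ p).symm) (chartAt ℂ p p)

/-- The differential `dz` of the chart `z = e`, evaluated on a tangent vector at `q`. -/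
def coordForm (e : OpenPartialHomeomorph S ℂ) (q : S) : TangentSpace 𝓘(ℂ) q →L[ℂ] ℂ :=
  mfderiv 𝓘(ℂ) 𝓘(ℂ) e q

/-- The coordinate vector field `∂/∂z` of the chart `z = e` (the vector with `dz (∂/∂z) = 1`). -/
def coordField (e : OpenPartialHomeomorph S ℂ) (q : S) : TangentSpace 𝓘(ℂ) q :=
  (coordForm e q).inverse (1 : ℂ)

/-- `X` is a meromorphic section of `TS` near `p`. -/
def MeromorphicFieldAt (X : Π q : S, TangentSpace 𝓘(ℂ) q) (p : S) : Prop :=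
  MeromorphicFunAt (fun q ↦ coordForm (chartAt ℂ p) q (X q)) p

/-- `A` is a meromorphic section of `T*S ⊗ TS = Hom (TS, TS)` near `p`, that is, a meromorphic
`1`-form with values in `TS`. -/
def MeromorphicFormAt (A : Π q : S, TangentSpace 𝓘(ℂ) q →L[ℂ] TangentSpace 𝓘(ℂ) q) (p : S) :
    Prop :=
  MeromorphicFunAt
    (fun q ↦ coordForm (chartAt ℂ p) q (A q (coordField (chartAt ℂ p) q))) p

/-- The tensor `df ⊗ X`, i.e. `u ↦ df(u) X`. -/
def dTensor (f : S → ℂ) (X : Π q : S, TangentSpace 𝓘(ℂ) q) (q : S) :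
    TangentSpace 𝓘(ℂ) q →L[ℂ] TangentSpace 𝓘(ℂ) q :=
  ContinuousLinearMap.smulRight
    (show TangentSpace 𝓘(ℂ) q →L[ℂ] ℂ from mfderiv 𝓘(ℂ) 𝓘(ℂ) f q) (X q)

variable (S) in
/-- A meromorphic connection on `TS`: a `ℂ`-linear morphism from the sheaf of germs of meromorphic
sections of `TS` to the sheaf of germs of meromorphic `TS`-valued `1`-forms that satisfies the
Leibniz rule `∇ (f X) = df ⊗ X + f ∇ X`. It is given by an operator on representatives; the field
`congr'` says that it is well defined on germs, and only its values on sections that are meromorphic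
near `p`, taken near `p`, matter. -/
structure MeromorphicConnection where
  toFun : (Π q : S, TangentSpace 𝓘(ℂ) q) →
    (Π q : S, TangentSpace 𝓘(ℂ) q →L[ℂ] TangentSpace 𝓘(ℂ) q)
  meromorphic' : ∀ X p, MeromorphicFieldAt X p → MeromorphicFormAt (toFun X) p
  congr' : ∀ X Y p, MeromorphicFieldAt X p → MeromorphicFieldAt Y p →
    (∀ᶠ q in 𝓝[≠] p, X q = Y q) → ∀ᶠ q in 𝓝[≠] p, toFun X q = toFun Y q
  add' : ∀ X Y p, MeromorphicFieldAt X p → MeromorphicFieldAt Y p →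
    ∀ᶠ q in 𝓝[≠] p, toFun (fun x ↦ X x + Y x) q = toFun X q + toFun Y q
  smul' : ∀ (a : ℂ) X p, MeromorphicFieldAt X p →
    ∀ᶠ q in 𝓝[≠] p, toFun (fun x ↦ a • X x) q = a • toFun X q
  leibniz' : ∀ (f : S → ℂ) X p, MeromorphicFunAt f p → MeromorphicFieldAt X p →
    ∀ᶠ q in 𝓝[≠] p, toFun (fun x ↦ f x • X x) q = dTensor f X q + f q • toFun X q

variable (S) in
/-- The holomorphic coordinate charts of `S`. -/
abbrev holCharts : Set (OpenPartialHomeomorph S ℂ) := IsManifold.maximalAtlas 𝓘(ℂ) ω S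

/-- The residue at `z₀` of a function meromorphic near `z₀`: the value of
`(2πi)⁻¹ ∮ f(z) dz` over all sufficiently small circles around `z₀`. -/
def residueAt (f : ℂ → ℂ) (z₀ : ℂ) : ℂ :=
  limUnder (𝓝[>] (0 : ℝ)) fun r ↦ (2 * Real.pi * Complex.I)⁻¹ * ∮ z in C(z₀, r), f z

namespace MeromorphicConnection

variable (D : MeromorphicConnection S)

/-- The local representation `η = f dz` of the connection in the chart `z = e`, determined by
`∇ (∂/∂z) = η ⊗ ∂/∂z`: this is the coefficient `f`, as a function of `z ∈ e.target`, with removable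
singularities removed. -/
def localRep (e : OpenPartialHomeomorph S ℂ) : ℂ → ℂ :=
  toMeromorphicNFOn
    (fun z ↦ coordForm e (e.symm z)
      (D.toFun (coordField e) (e.symm z) (coordField e (e.symm z)))) e.target

/-- The order of the local representation at the point `p`. -/
def order (p : S) : WithTop ℤ :=
  meromorphicOrderAt (D.localRep (chartAt ℂ p)) (chartAt ℂ p p)

/-- The set of poles of the connection; its complement is `S°`. -/
def poles : Set S := {p | D.order p < 0}

/-- All poles are simple poles of the local representations. -/
def IsFuchsian : Prop := ∀ p ∈ D.poles, D.order p = -1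

/-- The residue of the connection at `p`. -/
def residue (p : S) : ℂ := residueAt (D.localRep (chartAt ℂ p)) (chartAt ℂ p p)

/-- The connection has monodromy in `G`: there is an atlas of `S° = S ∖ poles` consisting of
charts in which the connection is represented by `0`, with transition functions
`z_β = a z_α + c`, `a ∈ G`, `c ∈ ℂ`. -/
def HasMonodromyIn (G : Subgroup ℂˣ) : Prop :=
  ∃ A : Set (OpenPartialHomeomorph S ℂ),
    (∀ e ∈ A, e ∈ holCharts S ∧ e.source ⊆ D.polesᶜ ∧ ∀ z ∈ e.target, D.localRep e z = 0) ∧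
    (∀ p ∈ D.polesᶜ, ∃ e ∈ A, p ∈ e.source) ∧
    ∀ e ∈ A, ∀ e' ∈ A, ∃ a ∈ G, ∃ c : ℂ, ∀ p ∈ e.source ∩ e'.source, e' p = (a : ℂ) * e p + c

/-- The smooth curve `σ : I → S°`, with `I` a (nondegenerate) interval, is a geodesic:
`∇_{σ'} σ' = 0`, which in a local chart `z` in which `∇` is represented by `f dz` reads
`(z ∘ σ)'' + (f ∘ σ) ((z ∘ σ)')² = 0`. Derivatives at end points of `I` are one-sided. -/
structure IsGeodesic (σ : ℝ → S) (I : Set ℝ) : Prop where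
  ordConnected : I.OrdConnected
  nontrivial : I.Nontrivial
  mapsTo : MapsTo σ I D.polesᶜ
  continuousOn : ContinuousOn σ I
  smooth : ∀ e ∈ holCharts S, ∀ t ∈ I, σ t ∈ e.source → ContDiffWithinAt ℝ ∞ (e ∘ σ) I t
  equation : ∀ e ∈ holCharts S, ∀ t ∈ I, σ t ∈ e.source →
    derivWithin (derivWithin (e ∘ σ) I) I t +
      D.localRep e (e (σ t)) * derivWithin (e ∘ σ) I t ^ 2 = 0

end MeromorphicConnection

/-- The curve `σ : I → S` passes through some point of `S` at two different times. -/
def IsSelfIntersecting (σ : ℝ → S) (I : Set ℝ) : Prop :=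
  ∃ s ∈ I, ∃ t ∈ I, s ≠ t ∧ σ s = σ t

/-- The curve `σ : I → S` has the same position and the same velocity vector at the times
`s, t ∈ I`. -/
def SamePositionAndVelocity (σ : ℝ → S) (I : Set ℝ) (s t : ℝ) : Prop :=
  σ s = σ t ∧ ∀ e ∈ holCharts S, σ s ∈ e.source →
    derivWithin (e ∘ σ) I s = derivWithin (e ∘ σ) I t

/-- The curve `σ : I → S` is periodic: for some `l > 0` the interval `I` contains a segment
`[t, t + l]`, and over each such segment the curve closes up with the same velocity,
`σ (t + l) = σ t` and `σ' (t + l) = σ' t`. -/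
def IsPeriodic (σ : ℝ → S) (I : Set ℝ) : Prop :=
  ∃ l > 0, (∃ t ∈ I, t + l ∈ I) ∧
    ∀ t ∈ I, t + l ∈ I → SamePositionAndVelocity σ I t (t + l)

end RiemannSurface

end

/-! In a flat chart a geodesic is affine in time, and flat charts differ by `z ↦ ± z + c`, so the
square of the velocity is constant along the whole geodesic (`derivWithin_sq_eq`). If `σ s = σ t`
with `s < t`, the two velocities are therefore equal or opposite. If they are equal, `σ` and its
time translate by `t - s` have a common jet, and unique continuation (`sameJet_of_isPreconnected`)
gives the period `t - s`. If they are opposite, `σ` has the same jet at `s` as its time reversal `u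
↦ σ (s + t - u)`, hence agrees with it on `[s, t]`. At the midpoint the velocity is its own
negative, so it is zero there, and by constancy of its square it is zero everywhere. Both velocities
then vanish and are equal after all (`sameJet_of_eq`). -/

theorem Set.OrdConnected.uniqueDiffOn_real {I : Set ℝ} (hI : I.OrdConnected)
    (hI' : I.Nontrivial) : UniqueDiffOn ℝ I := by
  obtain ⟨a, ha, b, hb, hab⟩ := hI'.exists_lt
  refine uniqueDiffOn_convex hI.convex ⟨(a + b) / 2, ?_⟩
  exact interior_mono (hI.out ha hb) (by rw [interior_Icc]; constructor <;> linarith)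

/-- A curve in a normed space whose second derivative vanishes near `t` is affine near `t`. -/
theorem eventually_affine_of_derivWithin_derivWithin_eq_zero {E : Type*} [NormedAddCommGroup E]
    [NormedSpace ℝ E] {I : Set ℝ} (hI : I.OrdConnected) (hI' : I.Nontrivial) {g : ℝ → E} {t : ℝ}
    (ht : t ∈ I)
    (hg : ∀ᶠ u in 𝓝[I] t, ContDiffWithinAt ℝ 2 g I u ∧ derivWithin (derivWithin g I) I u = 0) :
    ∀ᶠ u in 𝓝[I] t, derivWithin g I u = derivWithin g I t ∧
      g u = g t + (u - t) • derivWithin g I t := by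
  obtain ⟨r, hr, hball⟩ := Metric.mem_nhdsWithin_iff.1 hg
  have hud := hI.uniqueDiffOn_real hI'
  have hconv : Convex ℝ (Metric.ball t r ∩ I) := (convex_ball t r).inter hI.convex
  have htJ : t ∈ Metric.ball t r ∩ I := ⟨Metric.mem_ball_self hr, ht⟩
  have hderiv : ∀ u ∈ Metric.ball t r ∩ I, derivWithin g I u = derivWithin g I t := by
    intro u hu
    have := hconv.norm_image_sub_le_of_norm_hasDerivWithin_le (f := derivWithin g I)
      (f' := fun _ ↦ 0) (C := 0) (fun x hx ↦ ?_) (by simp) htJ hu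
    · simpa [sub_eq_zero] using this
    · obtain ⟨hx1, hx2⟩ := hball hx
      have hd : DifferentiableWithinAt ℝ (derivWithin g I) I x :=
        (hx1.fderivWithin_right_apply (m := 1) (k := fun _ ↦ 1) contDiffWithinAt_const hud
          (by norm_num) hx.2).differentiableWithinAt (by simp)
      have := hd.hasDerivWithinAt
      rw [hx2] at this
      exact this.mono inter_subset_right
  refine Metric.mem_nhdsWithin_iff.2 ⟨r, hr, fun u hu ↦ ⟨hderiv u hu, ?_⟩⟩
  have := hconv.norm_image_sub_le_of_norm_hasDerivWithin_le
      (f := fun u ↦ g u - (u - t) • derivWithin g I t)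
      (f' := fun _ ↦ 0) (C := 0) (fun x hx ↦ ?_) (by simp) htJ hu
  · simp only [zero_mul, norm_le_zero_iff, sub_self, zero_smul, sub_zero] at this
    rw [← sub_eq_zero, ← this]
    abel
  · have h1 := ((hball hx).1.differentiableWithinAt (by simp)).hasDerivWithinAt
    have h2 := ((hasDerivWithinAt_id x I).sub_const t).smul_const (derivWithin g I t)
    have h3 := (h1.sub h2).mono (inter_subset_right (s := Metric.ball t r))
    rw [hderiv x hx, one_smul, sub_self] at h3
    exact h3

namespace RiemannSurface

variable {S : Type*} [TopologicalSpace S] [ChartedSpace ℂ S]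

/-- The velocities of a curve in two holomorphic charts differ by a factor depending only on the
position. -/
theorem exists_derivWithin_comp_eq_mul {e e' : OpenPartialHomeomorph S ℂ} (he : e ∈ holCharts S)
    (he' : e' ∈ holCharts S) {p : S} (hp : p ∈ e.source) (hp' : p ∈ e'.source) {I : Set ℝ}
    (hI : UniqueDiffOn ℝ I) :
    ∃ k : ℂ, ∀ (σ : ℝ → S) (t : ℝ), t ∈ I → σ t = p → ContinuousWithinAt σ I t →
      DifferentiableWithinAt ℝ (e ∘ σ) I t →
        derivWithin (e' ∘ σ) I t = derivWithin (e ∘ σ) I t * k := by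
  have hd : DifferentiableAt ℂ (e' ∘ e.symm) (e p) := by
    have h1 := contMDiffAt_symm_of_mem_maximalAtlas he (e.map_source hp)
    have h2 := contMDiffAt_of_mem_maximalAtlas he' hp'
    rw [← e.left_inv hp] at h2
    exact (h2.comp _ h1).contDiffAt.differentiableAt (by simp)
  refine ⟨deriv (e' ∘ e.symm) (e p), ?_⟩
  rintro σ t ht rfl hc hσ
  have hev : (e' ∘ e.symm) ∘ (e ∘ σ) =ᶠ[𝓝[I] t] e' ∘ σ := by
    filter_upwards [hc (e.open_source.mem_nhds hp)] with u hu
    simp [e.left_inv hu]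
  have := (HasDerivAt.scomp_hasDerivWithinAt t (h := e ∘ σ) hd.hasDerivAt hσ.hasDerivWithinAt)
  rw [← hev.derivWithin_eq_of_mem ht]
  simpa using this.derivWithin (hI t ht)

namespace MeromorphicConnection

variable {D : MeromorphicConnection S} {σ : ℝ → S} {I : Set ℝ}

/-- A holomorphic chart in which the connection is represented by `0`. -/
def IsFlatChart (D : MeromorphicConnection S) (e : OpenPartialHomeomorph S ℂ) : Prop :=
  e ∈ holCharts S ∧ ∀ z ∈ e.target, D.localRep e z = 0

/-- An atlas of `S°` by flat charts with transition functions `z ↦ ± z + c`. -/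
structure IsFlatAtlas (D : MeromorphicConnection S) (A : Set (OpenPartialHomeomorph S ℂ)) :
    Prop where
  isFlatChart : ∀ e ∈ A, D.IsFlatChart e
  exists_mem_source : ∀ p ∈ D.polesᶜ, ∃ e ∈ A, p ∈ e.source
  transition : ∀ e ∈ A, ∀ e' ∈ A, ∃ a c : ℂ, a ^ 2 = 1 ∧
    ∀ p ∈ e.source ∩ e'.source, e' p = a * e p + c

theorem HasMonodromyIn.exists_isFlatAtlas (h : D.HasMonodromyIn (rootsOfUnity 2 ℂ)) :
    ∃ A, D.IsFlatAtlas A := by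
  obtain ⟨A, hA, hcover, htrans⟩ := h
  refine ⟨A, fun e he ↦ ⟨(hA e he).1, (hA e he).2.2⟩, hcover, fun e he e' he' ↦ ?_⟩
  obtain ⟨a, ha, c, h⟩ := htrans e he e' he'
  refine ⟨a, c, ?_, h⟩
  rw [← Units.val_pow_eq_pow_val, (mem_rootsOfUnity 2 a).1 ha, Units.val_one]

/-! ### Geodesics in flat charts. -/

namespace IsGeodesic

theorem uniqueDiffOn (hσ : D.IsGeodesic σ I) : UniqueDiffOn ℝ I :=
  hσ.ordConnected.uniqueDiffOn_real hσ.nontrivial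

theorem eventually_mem_source (hσ : D.IsGeodesic σ I) {e : OpenPartialHomeomorph S ℂ} {t : ℝ}
    (ht : t ∈ I) (hte : σ t ∈ e.source) : ∀ᶠ u in 𝓝[I] t, σ u ∈ e.source :=
  hσ.continuousOn t ht (e.open_source.mem_nhds hte)

/-- Geodesics are affine in flat charts. -/
theorem eventually_affine (hσ : D.IsGeodesic σ I) {e : OpenPartialHomeomorph S ℂ}
    (he : D.IsFlatChart e) {t : ℝ} (ht : t ∈ I) (hte : σ t ∈ e.source) :
    ∀ᶠ u in 𝓝[I] t, σ u ∈ e.source ∧ derivWithin (e ∘ σ) I u = derivWithin (e ∘ σ) I t ∧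
      e (σ u) = e (σ t) + (u - t) • derivWithin (e ∘ σ) I t := by
  have hmem := hσ.eventually_mem_source ht hte
  refine hmem.and <| eventually_affine_of_derivWithin_derivWithin_eq_zero hσ.ordConnected
    hσ.nontrivial ht ?_
  filter_upwards [hmem, self_mem_nhdsWithin] with u hu huI
  refine ⟨(hσ.smooth e he.1 u huI hu).of_le (WithTop.coe_le_coe.2 le_top), ?_⟩
  simpa [he.2 _ (e.map_source hu)] using hσ.equation e he.1 u huI hu

theorem derivWithin_transition (hσ : D.IsGeodesic σ I) {e e' : OpenPartialHomeomorph S ℂ}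
    {a c : ℂ} (h : ∀ p ∈ e.source ∩ e'.source, e' p = a * e p + c) {t : ℝ} (ht : t ∈ I)
    (hte : σ t ∈ e.source) (hte' : σ t ∈ e'.source) :
    derivWithin (e' ∘ σ) I t = a * derivWithin (e ∘ σ) I t := by
  have hev : e' ∘ σ =ᶠ[𝓝[I] t] fun u ↦ a * (e ∘ σ) u + c := by
    filter_upwards [hσ.eventually_mem_source ht hte, hσ.eventually_mem_source ht hte']
      with u hu hu' using h _ ⟨hu, hu'⟩
  rw [hev.derivWithin_eq_of_mem ht, derivWithin_add_const, derivWithin_const_mul_field]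

variable {A : Set (OpenPartialHomeomorph S ℂ)}

/-- The square of the velocity in flat charts is constant along a geodesic. -/
theorem derivWithin_sq_eq (hσ : D.IsGeodesic σ I) (hA : D.IsFlatAtlas A) {s t : ℝ} (hs : s ∈ I)
    (ht : t ∈ I) {e e' : OpenPartialHomeomorph S ℂ} (he : e ∈ A) (he' : e' ∈ A)
    (hse : σ s ∈ e.source) (hte : σ t ∈ e'.source) :
    derivWithin (e ∘ σ) I s ^ 2 = derivWithin (e' ∘ σ) I t ^ 2 := by
  have hsame : ∀ u ∈ I, ∀ e ∈ A, ∀ e' ∈ A, σ u ∈ e.source → σ u ∈ e'.source →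
      derivWithin (e ∘ σ) I u ^ 2 = derivWithin (e' ∘ σ) I u ^ 2 := by
    intro u hu e he e' he' hue hue'
    obtain ⟨a, c, ha, h⟩ := hA.transition e he e' he'
    rw [hσ.derivWithin_transition h hu hue hue', mul_pow, ha, one_mul]
  have : Nonempty (OpenPartialHomeomorph S ℂ) := ⟨e⟩
  choose! f hfA hf using fun u (hu : u ∈ I) ↦ hA.exists_mem_source _ (hσ.mapsTo hu)
  have hconst : derivWithin (f s ∘ σ) I s ^ 2 = derivWithin (f t ∘ σ) I t ^ 2 := by
    -- It suffices that the square is locally constant: near `x` the single chart `f x` serves, and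
    -- `hsame` passes from it to `f y`.
    refine hσ.ordConnected.isPreconnected.induction₂
      (fun x y ↦ derivWithin (f x ∘ σ) I x ^ 2 = derivWithin (f y ∘ σ) I y ^ 2)
      (fun x hx ↦ ?_) (fun x y z _ _ _ h h' ↦ h.trans h') (fun x y _ _ h ↦ h.symm) hs ht
    filter_upwards [hσ.eventually_affine (hA.isFlatChart _ (hfA x hx)) hx (hf x hx),
      self_mem_nhdsWithin] with y hy hyI
    rw [← hy.2.1]
    exact hsame y hyI _ (hfA x hx) _ (hfA y hyI) hy.1 (hf y hyI)
  exact (hsame s hs _ he _ (hfA s hs) hse (hf s hs)).trans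
    (hconst.trans (hsame t ht _ (hfA t ht) _ he' (hf t ht) hte))

/-! ### Jets and unique continuation. -/

/-- The germs at `u` of `σ` and of its reparametrization with speed `ε` that is at `σ v` at the
time `u` agree to first order in the charts of `A`. -/
def SameJet (A : Set (OpenPartialHomeomorph S ℂ)) (σ : ℝ → S) (I : Set ℝ) (ε u v : ℝ) : Prop :=
  σ u = σ v ∧ ∀ e ∈ A, σ u ∈ e.source →
    derivWithin (e ∘ σ) I u = ε • derivWithin (e ∘ σ) I v

/-- One chart suffices, because a transition map multiplies both velocities by the same constant
`a`. -/
theorem sameJet_of_mem_source (hσ : D.IsGeodesic σ I) (hA : D.IsFlatAtlas A) {ε u v : ℝ}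
    (hu : u ∈ I) (hv : v ∈ I) (huv : σ u = σ v) {e : OpenPartialHomeomorph S ℂ} (he : e ∈ A)
    (hue : σ u ∈ e.source) (h : derivWithin (e ∘ σ) I u = ε • derivWithin (e ∘ σ) I v) :
    SameJet A σ I ε u v := by
  refine ⟨huv, fun e' he' hue' ↦ ?_⟩
  obtain ⟨a, c, -, hac⟩ := hA.transition e he e' he'
  rw [hσ.derivWithin_transition hac hu hue hue',
    hσ.derivWithin_transition hac hv (huv ▸ hue) (huv ▸ hue'), h, mul_smul_comm]

/-- Unique continuation: a geodesic and an affine reparametrization of it with the same jet at one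
time have the same jet at all times of an interval. -/
theorem sameJet_of_isPreconnected [T2Space S] (hσ : D.IsGeodesic σ I) (hA : D.IsFlatAtlas A)
    {ε c : ℝ} {J : Set ℝ} (hJ : IsPreconnected J) (hJI : J ⊆ I)
    (hJI' : MapsTo (fun u ↦ ε * u + c) J I) {x y : ℝ} (hx : x ∈ J) (hy : y ∈ J)
    (h : SameJet A σ I ε x (ε * x + c)) : SameJet A σ I ε y (ε * y + c) := by
  -- Induction on a preconnected set needs a symmetric relation. The equivalence is one, and proving
  -- it locally shows at once that the set of agreement is open and closed in `J`.
  suffices SameJet A σ I ε x (ε * x + c) ↔ SameJet A σ I ε y (ε * y + c) from this.1 h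
  refine hJ.induction₂ (fun x y ↦ SameJet A σ I ε x (ε * x + c) ↔ SameJet A σ I ε y (ε * y + c))
    (fun u hu ↦ ?_) (fun x y z _ _ _ h h' ↦ h.trans h') (fun x y _ _ h ↦ h.symm) hx hy
  have hτ : Tendsto (fun u ↦ ε * u + c) (𝓝[J] u) (𝓝[I] (ε * u + c)) :=
    ContinuousWithinAt.tendsto_nhdsWithin (by fun_prop) hJI'
  have hid : 𝓝[J] u ≤ 𝓝[I] u := nhdsWithin_mono u hJI
  by_cases huv : σ u = σ (ε * u + c)
  · obtain ⟨e, he, hue⟩ := hA.exists_mem_source _ (hσ.mapsTo (hJI hu))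
    filter_upwards [hid (hσ.eventually_affine (hA.isFlatChart e he) (hJI hu) hue),
      hτ (hσ.eventually_affine (hA.isFlatChart e he) (hJI' hu) (huv ▸ hue)),
      self_mem_nhdsWithin] with v ⟨hv1, hv2, hv3⟩ ⟨hv1', hv2', hv3'⟩ hvJ
    constructor
    · intro hP
      have hd := hP.2 e he hue
      refine hσ.sameJet_of_mem_source hA (hJI hvJ) (hJI' hvJ) (e.injOn hv1 hv1' ?_) he hv1 ?_
      · rw [hv3, hv3', hd, ← huv, smul_smul]
        congr 2
        ring
      · rw [hv2, hv2', hd]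
    -- The positions at `u` agree by `huv`, so only the velocities, locally constant in `e`, have to
    -- be carried back from `v` to `u`.
    · intro hP
      refine hσ.sameJet_of_mem_source hA (hJI hu) (hJI' hu) huv he hue ?_
      rw [← hv2, ← hv2']
      exact hP.2 e he hv1
  -- Distinct points stay distinct nearby since `S` is Hausdorff, so both sides of the equivalence
  -- fail.
  · have h1 : Tendsto (fun v ↦ (σ v, σ (ε * v + c))) (𝓝[J] u) (𝓝 (σ u, σ (ε * u + c))) :=
      ((hσ.continuousOn u (hJI hu)).mono_left hid).prodMk_nhds
        ((hσ.continuousOn _ (hJI' hu)).tendsto.comp hτ)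
    filter_upwards [h1 (isClosed_diagonal.isOpen_compl.mem_nhds huv)] with v hv
    exact iff_of_false (fun h ↦ huv h.1) (fun h ↦ hv h.1)

/-- Passes from the charts of `A` to all holomorphic charts: the factor `k` depends only on the
common point, so it is the same at both times. -/
theorem SameJet.samePositionAndVelocity (hσ : D.IsGeodesic σ I) (hA : D.IsFlatAtlas A) {u v : ℝ}
    (hu : u ∈ I) (hv : v ∈ I) (h : SameJet A σ I 1 u v) : SamePositionAndVelocity σ I u v := by
  refine ⟨h.1, fun e' he' hue' ↦ ?_⟩
  obtain ⟨e, he, hue⟩ := hA.exists_mem_source _ (hσ.mapsTo hu)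
  have heh := (hA.isFlatChart e he).1
  obtain ⟨k, hk⟩ := exists_derivWithin_comp_eq_mul heh he' hue hue' hσ.uniqueDiffOn
  have hdiff : ∀ w ∈ I, σ w = σ u → DifferentiableWithinAt ℝ (e ∘ σ) I w := fun w hw hwu ↦
    (hσ.smooth e heh w hw (hwu ▸ hue)).differentiableWithinAt (by simp)
  rw [hk σ u hu rfl (hσ.continuousOn u hu) (hdiff u hu rfl),
    hk σ v hv h.1.symm (hσ.continuousOn v hv) (hdiff v hv h.1.symm), h.2 e he hue, one_smul]

/-! ### Self-intersections and periodicity. -/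

/-- A self-intersecting geodesic passes through the point with the same velocity both times:
otherwise it would turn back halfway between the two times. -/
theorem sameJet_of_eq [T2Space S] (hσ : D.IsGeodesic σ I) (hA : D.IsFlatAtlas A) {s t : ℝ}
    (hs : s ∈ I) (ht : t ∈ I) (hst : s < t) (h : σ s = σ t) : SameJet A σ I 1 s t := by
  obtain ⟨e, he, hse⟩ := hA.exists_mem_source _ (hσ.mapsTo hs)
  rcases sq_eq_sq_iff_eq_or_eq_neg.1 (hσ.derivWithin_sq_eq hA hs ht he he hse (h ▸ hse))
    with hd | hd
  · exact hσ.sameJet_of_mem_source hA hs ht h he hse (by rw [one_smul, hd])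
  · have hI := hσ.ordConnected.out hs ht
    have hmaps : MapsTo (fun u ↦ (-1) * u + (s + t)) (Icc s t) I := fun u hu ↦
      hI ⟨by linarith [hu.2], by linarith [hu.1]⟩
    have hjet : SameJet A σ I (-1) s (-1 * s + (s + t)) := by
      rw [show -1 * s + (s + t) = t by ring]
      exact hσ.sameJet_of_mem_source hA hs ht h he hse (by rw [neg_one_smul, hd])
    -- The midpoint is the fixed point of the reflection `u ↦ s + t - u`.
    have hm : (s + t) / 2 ∈ Icc s t := ⟨by linarith, by linarith⟩
    have hmid := hσ.sameJet_of_isPreconnected hA isPreconnected_Icc hI hmaps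
      (left_mem_Icc.2 hst.le) hm hjet
    rw [show -1 * ((s + t) / 2) + (s + t) = (s + t) / 2 by ring] at hmid
    obtain ⟨e', he', hme⟩ := hA.exists_mem_source _ (hσ.mapsTo (hI hm))
    have hzero : derivWithin (e' ∘ σ) I ((s + t) / 2) = 0 := by
      have := hmid.2 e' he' hme
      rwa [neg_one_smul, self_eq_neg] at this
    have hs0 : derivWithin (e ∘ σ) I s = 0 := by
      have := hσ.derivWithin_sq_eq hA hs (hI hm) he he' hse hme
      rwa [hzero, zero_pow two_ne_zero, sq_eq_zero_iff] at this
    rw [hs0, zero_eq_neg] at hd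
    exact hσ.sameJet_of_mem_source hA hs ht h he hse (by rw [hs0, hd, smul_zero])

theorem isPeriodic_of_eq [T2Space S] (hσ : D.IsGeodesic σ I) (hA : D.IsFlatAtlas A) {s t : ℝ}
    (hs : s ∈ I) (ht : t ∈ I) (hst : s < t) (h : σ s = σ t) : IsPeriodic σ I := by
  refine ⟨t - s, sub_pos.2 hst, ⟨s, hs, by simpa using ht⟩, fun u hu hu' ↦ ?_⟩
  -- The times at which both `σ` and its translate are defined form an interval containing `s`, from
  -- which the jet is continued.
  have hJ : IsPreconnected {u | u ∈ I ∧ u + (t - s) ∈ I} := by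
    refine OrdConnected.isPreconnected ⟨fun a ha b hb v hv ↦ ?_⟩
    exact ⟨hσ.ordConnected.out ha.1 hb.1 hv,
      hσ.ordConnected.out ha.2 hb.2 ⟨by linarith [hv.1], by linarith [hv.2]⟩⟩
  have := hσ.sameJet_of_isPreconnected hA (ε := 1) (c := t - s) hJ (fun _ hv ↦ hv.1)
    (fun _ hv ↦ by simpa using hv.2) (x := s) (y := u) ⟨hs, by simpa using ht⟩ ⟨hu, hu'⟩
    (by simpa using hσ.sameJet_of_eq hA hs ht hst h)
  rw [one_mul] at this
  exact this.samePositionAndVelocity hσ hA hu hu'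

end IsGeodesic

end MeromorphicConnection

end RiemannSurface

theorem mainTheorem9 {S : Type*} [TopologicalSpace S] [T2Space S] [ConnectedSpace S]
    [ChartedSpace ℂ S] [IsManifold 𝓘(ℂ) ω S]
    (D : RiemannSurface.MeromorphicConnection S)
    (hFuchs : D.IsFuchsian)
    (hMon : D.HasMonodromyIn (rootsOfUnity 2 ℂ))
    (hRes : ∀ p : S, ∃ m : ℤ, D.residue p = (m : ℂ) / 2)
    (σ : ℝ → S) (I : Set ℝ) (hσ : D.IsGeodesic σ I)
    (hself : RiemannSurface.IsSelfIntersecting σ I) :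
    RiemannSurface.IsPeriodic σ I := by
  obtain ⟨A, hA⟩ := hMon.exists_isFlatAtlas
  obtain ⟨s, hs, t, ht, hne, h⟩ := hself
  rcases hne.lt_or_gt with hst | hst
  · exact hσ.isPeriodic_of_eq hA hs ht hst h
  · exact hσ.isPeriodic_of_eq hA ht hs hst h.symm
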